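/- Let $[n]=\{1,\dots,n\}$ and let $2^{[n]}$ be the family of all subsets of $[n]$. For a finite poset $P$, a family $\mathcal G\subseteq 2^{[n]}$ is an induced copy of $P$ if there is a bijection $i:P\to\mathcal G$ such that for all $p,q\in P$ we have $p\le q$ if and only if $i(p)\subseteq i(q)$. A family $\mathcal F\subseteq 2^{[n]}$ is induced $P$-free if no $\mathcal G\subseteq\mathcal F$ is an induced copy of $P$. The complete multipartite poset $K_{r_1,\dots,r_\ell}$ has elements $a_{i,j}$ ($1\le i\le \ell$, $1\le j\le r_i$), with $a_{i,j}<a_{i',j'}$ if and only if $i<i'$; write $\vee_r=K_{1,r}$. (i) For every fixed integer $r\ge 1$, the number of induced $\vee_r$-free families $\mathcal F\subseteq 2^{[n]}$ is $2^{(1+o(1))\binom{n}{\lfloor n/2\rfloor}}$ as $n\to\infty$. (ii) For all fixed integers $s,t\ge 1$, the number of induced $K_{s,1,t}$-free families $\mathcal F\subseteq 2^{[n]}$ is $2^{(2+o(1))\binom{n}{\lfloor n/2\rfloor}}$ as $n\to\infty$. -/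

import Mathlib

open Filter Topology

/-- The complete multipartite poset `K_{r₀, …, r_{ℓ-1}}`: its elements are `a_{i,j}` with
`i : Fin ℓ` (the part) and `j : Fin (r i)` (the index within the part). -/
@[ext]
structure MultipartitePoset {l : ℕ} (r : Fin l → ℕ) where
  part : Fin l
  index : Fin (r part)

/-- `a_{i,j} < a_{i',j'}` if and only if `i < i'`. -/
instance {l : ℕ} (r : Fin l → ℕ) : PartialOrder (MultipartitePoset r) where
  le a b := a = b ∨ a.part < b.part
  lt a b := a.part < b.part
  le_refl _ := Or.inl rfl
  le_trans a b c hab hbc := by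
    rcases hab with rfl | hab
    · exact hbc
    · rcases hbc with rfl | hbc
      · exact Or.inr hab
      · exact Or.inr (hab.trans hbc)
  lt_iff_le_not_ge a b := by
    constructor
    · intro h
      refine ⟨Or.inr h, ?_⟩
      rintro (rfl | h')
      · exact lt_irrefl _ h
      · exact lt_asymm h h'
    · rintro ⟨rfl | h, h'⟩
      · exact absurd (Or.inl rfl) h'
      · exact h
  le_antisymm a b hab hba := by
    rcases hab with rfl | hab
    · rfl
    · rcases hba with rfl | hba
      · rfl
      · exact absurd hba (lt_asymm hab)

/-- The poset `∨_r = K_{1,r}`: one bottom element below `r` pairwise incomparable elements. -/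
abbrev VeePoset (r : ℕ) : Type := MultipartitePoset ![1, r]

/-- The poset `K_{s,1,t}`. -/
abbrev KPoset (s t : ℕ) : Type := MultipartitePoset ![s, 1, t]

/-- The family `𝒢` of subsets of an `n`-element set is an induced copy of the poset `P`:
there is a bijection `i : P → 𝒢` with `p ≤ q` if and only if `i p ⊆ i q`. -/
def IsInducedCopy (P : Type*) [PartialOrder P] {n : ℕ} (𝒢 : Finset (Finset (Fin n))) : Prop :=
  ∃ i : P ≃ {A : Finset (Fin n) // A ∈ 𝒢}, ∀ p q : P, p ≤ q ↔ (i p).1 ⊆ (i q).1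

/-- The family `ℱ` is induced `P`-free: no subfamily of `ℱ` is an induced copy of `P`. -/
def IsInducedFree (P : Type*) [PartialOrder P] {n : ℕ} (ℱ : Finset (Finset (Fin n))) : Prop :=
  ∀ 𝒢 : Finset (Finset (Fin n)), 𝒢 ⊆ ℱ → ¬ IsInducedCopy P 𝒢

/-- The number of induced `P`-free families in `2^{[n]}`. -/
noncomputable def numInducedFree (P : Type*) [PartialOrder P] (n : ℕ) : ℕ :=
  Nat.card {ℱ : Finset (Finset (Fin n)) // IsInducedFree P ℱ}

/-! Write `C` for the middle binomial coefficient. The lower bounds come from all subfamilies of one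
middle layer, respectively of two consecutive ones.

For the upper bounds, equal-sized sets form an antichain. So in a `∨_r`-free family every member has
fewer than `r` strict supersets of each size (`UpSparse`). In a `K_{s,1,t}`-free family every member
has few supersets or few subsets of each size; complementing the second kind reduces (ii) to a
product of two counts of `UpSparse` families.

Those are counted by a weighted container argument. Give a pair `a ⊂ b` the weight `1 / (|b| choose
|a|)`. Sparsity caps the load that a family puts on each of its members, and the caps sum to `O(2^n
/ n)`. Supersaturation, a Lubell-type inequality, puts in any collection of more than `C / (1 - δ)`
sets one whose weighted down-degree is at least `δ`. Branching on such sets leaves a factor `2 ^ (C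
/ (1 - δ))` times an error with exponent `O(C log n / √n)`, because `2^n = O(√n C)`. -/

/-! ### Weighted container count -/

/-- `T` is the part of `F` already chosen, `A` the elements still undecided. Branch on a vertex `v`
of large degree: rejecting it shrinks `A`, accepting it also lowers the potential in the exponent of
`y` by `δ`. The bound solves this recursion, `y⁻¹` paying for each acceptance. -/
theorem card_filter_subset_le_of_weight {V : Type*} [DecidableEq V] (w : V → V → ℝ) (c : V → ℝ)
    (hw : ∀ v a, 0 ≤ w v a) (hwc : ∀ v a, w v a ≤ c a) (S : Finset (Finset V))
    (hS : ∀ F ∈ S, ∀ a ∈ F, ∑ v ∈ F, w v a ≤ c a) {M δ y : ℝ} (hδ : 0 < δ) (hy : 1 ≤ y)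
    (hsat : ∀ A : Finset V, M < A.card → ∃ v ∈ A, δ ≤ ∑ a ∈ A, w v a) (k : ℕ) :
    ∀ A T : Finset V, A.card = k → Disjoint A T → (∀ a ∈ A, ∑ v ∈ T, w v a ≤ c a) →
      (({F ∈ S | T ⊆ F ∧ F ⊆ T ∪ A} : Finset (Finset V)).card : ℝ) ≤
        (1 + y⁻¹) ^ k * y ^ ((∑ a ∈ A, (2 * c a - ∑ v ∈ T, w v a)) / δ) * (2 : ℝ) ^ M := by
  have hy0 : 0 < y := by linarith
  have hyi : 0 < y⁻¹ := inv_pos.2 hy0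
  have hc0 : ∀ a, 0 ≤ c a := fun a => (hw a a).trans (hwc a a)
  induction k using Nat.strong_induction_on with
  | _ k ih =>
  intro A T hk hAT hcap
  have hpos : ∀ a ∈ A, 0 ≤ 2 * c a - ∑ v ∈ T, w v a := fun a ha => by
    linarith [hcap a ha, hc0 a]
  by_cases hM : M < A.card
  · obtain ⟨v, hvA, hv⟩ := hsat A hM
    have hvT : v ∉ T := Finset.disjoint_left.1 hAT hvA
    have hk1 : (A.erase v).card = k - 1 := by rw [Finset.card_erase_of_mem hvA, hk]
    have hkpos : 0 < k := hk ▸ Finset.card_pos.2 ⟨v, hvA⟩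
    -- Once `v` is accepted, elements loaded beyond their capacity can lie in no admissible `F`, so
    -- they are dropped.
    set A' := {a ∈ A.erase v | ∑ u ∈ insert v T, w u a ≤ c a} with hA'
    have hA'sub : A' ⊆ A.erase v := Finset.filter_subset _ _
    have hA'A : A' ⊆ A := hA'sub.trans (Finset.erase_subset _ _)
    have h1 := ih (k - 1) (by omega) (A.erase v) T hk1
      (hAT.mono_left (Finset.erase_subset _ _)) (fun a ha => hcap a (Finset.mem_of_mem_erase ha))
    have hA'card : A'.card ≤ k - 1 := hk1 ▸ Finset.card_le_card hA'sub
    have h2 := ih A'.card (by omega) A' (insert v T) rfl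
      (by
        rw [Finset.disjoint_insert_right]
        exact ⟨fun h => Finset.notMem_erase v A (hA'sub h), hAT.mono_left hA'A⟩)
      (fun a ha => (Finset.mem_filter.1 ha).2)
    set Φ := ∑ a ∈ A, (2 * c a - ∑ u ∈ T, w u a) with hΦ
    have hΦ1 : ∑ a ∈ A.erase v, (2 * c a - ∑ u ∈ T, w u a) ≤ Φ :=
      Finset.sum_le_sum_of_subset_of_nonneg (Finset.erase_subset _ _) (fun a ha _ => hpos a ha)
    have hΦ2 : ∑ a ∈ A', (2 * c a - ∑ u ∈ insert v T, w u a) ≤ Φ - δ := by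
      calc _ ≤ ∑ a ∈ A, (2 * c a - ∑ u ∈ insert v T, w u a) := by
            -- The potential uses `2 * c a` because the load, at most `c a` before, may overshoot by
            -- `w v a ≤ c a`; dropped terms thus stay nonnegative.
            refine Finset.sum_le_sum_of_subset_of_nonneg hA'A (fun a ha _ => ?_)
            rw [Finset.sum_insert hvT]
            linarith [hcap a ha, hwc v a]
        _ = Φ - ∑ a ∈ A, w v a := by
            rw [hΦ, ← Finset.sum_sub_distrib]
            refine Finset.sum_congr rfl (fun a _ => ?_)
            rw [Finset.sum_insert hvT]; ring
        _ ≤ _ := by linarith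
    have hsplit : ({F ∈ S | T ⊆ F ∧ F ⊆ T ∪ A} : Finset (Finset V)) ⊆
        {F ∈ S | T ⊆ F ∧ F ⊆ T ∪ A.erase v} ∪
          {F ∈ S | insert v T ⊆ F ∧ F ⊆ insert v T ∪ A'} := by
      intro F hF
      obtain ⟨hFS, hTF, hFA⟩ := Finset.mem_filter.1 hF
      by_cases hvF : v ∈ F
      · refine Finset.mem_union_right _ (Finset.mem_filter.2 ⟨hFS, ?_, fun u hu => ?_⟩)
        · exact Finset.insert_subset hvF hTF
        · by_cases huT : u ∈ insert v T
          · exact Finset.mem_union_left _ huT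
          · rw [Finset.mem_insert, not_or] at huT
            refine Finset.mem_union_right _ (Finset.mem_filter.2 ⟨Finset.mem_erase.2 ⟨huT.1, ?_⟩, ?_⟩)
            · exact (Finset.mem_union.1 (hFA hu)).resolve_left huT.2
            · exact (Finset.sum_le_sum_of_subset_of_nonneg (Finset.insert_subset hvF hTF)
                (fun _ _ _ => hw _ _)).trans (hS F hFS u hu)
      · refine Finset.mem_union_left _ (Finset.mem_filter.2 ⟨hFS, hTF, fun u hu => ?_⟩)
        rcases Finset.mem_union.1 (hFA hu) with h | h
        · exact Finset.mem_union_left _ h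
        · exact Finset.mem_union_right _ (Finset.mem_erase.2 ⟨fun e => hvF (e ▸ hu), h⟩)
    have hcard := (Finset.card_le_card hsplit).trans (Finset.card_union_le _ _)
    have h2M : (0 : ℝ) < 2 ^ M := Real.rpow_pos_of_pos two_pos _
    have hb1 : (1 + y⁻¹) ^ (k - 1) * y ^ ((∑ a ∈ A.erase v, (2 * c a - ∑ u ∈ T, w u a)) / δ) *
        (2 : ℝ) ^ M ≤ (1 + y⁻¹) ^ (k - 1) * y ^ (Φ / δ) * (2 : ℝ) ^ M := by
      gcongr
    have hb2 : (1 + y⁻¹) ^ A'.card * y ^ ((∑ a ∈ A', (2 * c a - ∑ u ∈ insert v T, w u a)) / δ) *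
        (2 : ℝ) ^ M ≤ (1 + y⁻¹) ^ (k - 1) * (y ^ (Φ / δ) * y⁻¹) * (2 : ℝ) ^ M := by
      have : y ^ (Φ / δ) * y⁻¹ = y ^ ((Φ - δ) / δ) := by
        rw [sub_div, div_self hδ.ne', Real.rpow_sub hy0, Real.rpow_one,
          div_eq_mul_inv (y ^ (Φ / δ))]
      rw [this]
      gcongr
      linarith
    refine ((Nat.cast_le (α := ℝ)).2 hcard).trans ?_
    rw [Nat.cast_add]
    refine (add_le_add (h1.trans hb1) (h2.trans hb2)).trans_eq ?_
    obtain ⟨k, rfl⟩ : ∃ j, k = j + 1 := ⟨k - 1, by omega⟩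
    rw [Nat.add_sub_cancel]
    ring
  · have hsub : ({F ∈ S | T ⊆ F ∧ F ⊆ T ∪ A} : Finset (Finset V)) ⊆ A.powerset.image (T ∪ ·) := by
      intro F hF
      obtain ⟨-, hTF, hFA⟩ := Finset.mem_filter.1 hF
      refine Finset.mem_image.2 ⟨F ∩ A, Finset.mem_powerset.2 Finset.inter_subset_right, ?_⟩
      ext u
      have := @hTF u
      have := @hFA u
      simp only [Finset.mem_union, Finset.mem_inter] at *
      tauto
    have hcard := (Finset.card_le_card hsub).trans Finset.card_image_le
    rw [Finset.card_powerset] at hcard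
    have h1 : (1 : ℝ) ≤ (1 + y⁻¹) ^ k := one_le_pow₀ (by linarith)
    have h2 : (1 : ℝ) ≤ y ^ ((∑ a ∈ A, (2 * c a - ∑ v ∈ T, w v a)) / δ) :=
      Real.one_le_rpow hy (div_nonneg (Finset.sum_nonneg hpos) hδ.le)
    have h3 : ((2 : ℝ) ^ A.card) ≤ 2 ^ M := by
      rw [← Real.rpow_natCast]
      exact Real.rpow_le_rpow_of_exponent_le one_le_two (not_lt.1 hM)
    calc (({F ∈ S | T ⊆ F ∧ F ⊆ T ∪ A} : Finset (Finset V)).card : ℝ) ≤ 2 ^ A.card := by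
          exact_mod_cast hcard
      _ ≤ 2 ^ M := h3
      _ ≤ _ := le_mul_of_one_le_left (Real.rpow_nonneg zero_le_two _) (one_le_mul_of_one_le_of_one_le h1 h2)

theorem card_le_of_weight {V : Type*} [DecidableEq V] [Fintype V] (w : V → V → ℝ) (c : V → ℝ)
    (hw : ∀ v a, 0 ≤ w v a) (hwc : ∀ v a, w v a ≤ c a) (S : Finset (Finset V))
    (hS : ∀ F ∈ S, ∀ a ∈ F, ∑ v ∈ F, w v a ≤ c a) {M δ y : ℝ} (hδ : 0 < δ) (hy : 1 ≤ y)
    (hsat : ∀ A : Finset V, M < A.card → ∃ v ∈ A, δ ≤ ∑ a ∈ A, w v a) :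
    (S.card : ℝ) ≤ (1 + y⁻¹) ^ Fintype.card V * y ^ (2 * (∑ a, c a) / δ) * (2 : ℝ) ^ M := by
  have := card_filter_subset_le_of_weight w c hw hwc S hS hδ hy hsat _ Finset.univ ∅ rfl
    (Finset.disjoint_empty_right _) (fun a _ => by simpa using (hw a a).trans (hwc a a))
  simpa [← Finset.mul_sum] using this

/-! ### Supersaturation from a Lubell-type inequality -/

/-- The mean number of members of `A` strictly below `b` on a random maximal chain through `b`. -/
noncomputable def lymDegree {α : Type*} [DecidableEq α] (A : Finset (Finset α)) (b : Finset α) : ℝ :=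
  ∑ a ∈ A with a ⊂ b, ((b.card.choose a.card : ℕ) : ℝ)⁻¹

theorem lymDegree_nonneg {α : Type*} [DecidableEq α] (A : Finset (Finset α)) (b : Finset α) :
    0 ≤ lymDegree A b :=
  Finset.sum_nonneg fun _ _ => by positivity

theorem inv_choose_eq_of_lt {m k : ℕ} (h : k < m) :
    ((m.choose k : ℕ) : ℝ)⁻¹ = (m : ℝ)⁻¹ * (((m - k : ℕ) : ℝ) * (((m - 1).choose k : ℕ) : ℝ)⁻¹) := by
  obtain ⟨m, rfl⟩ : ∃ j, m = j + 1 := ⟨m - 1, by omega⟩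
  have h1 : ((m + 1 : ℕ) : ℝ) * (m.choose k : ℕ) = ((m + 1).choose k : ℕ) * ((m + 1 - k : ℕ) : ℝ) := by
    rw [mul_comm]
    exact_mod_cast Nat.choose_mul_succ_eq m k
  have h2 : (0 : ℝ) < (m.choose k : ℕ) := by exact_mod_cast Nat.choose_pos (by omega)
  have h3 : (0 : ℝ) < ((m + 1).choose k : ℕ) := by exact_mod_cast Nat.choose_pos (by omega)
  have h4 : (0 : ℝ) < ((m + 1 : ℕ) : ℝ) := by positivity
  rw [Nat.add_sub_cancel]
  field_simp
  linarith

/-- A random maximal chain below `B` next passes through `B.erase x` with `x` uniform in `B`; it can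
still meet `b` only if `x ∉ b`. -/
theorem sum_ssubset_div_choose_eq {α : Type*} [DecidableEq α] (A : Finset (Finset α))
    (f : Finset α → ℝ) (B : Finset α) :
    ∑ b ∈ A with b ⊂ B, f b * ((B.card.choose b.card : ℕ) : ℝ)⁻¹ =
      (B.card : ℝ)⁻¹ * ∑ x ∈ B, ∑ b ∈ A with b ⊆ B.erase x,
        f b * (((B.erase x).card.choose b.card : ℕ) : ℝ)⁻¹ := by
  have hswap : ∑ x ∈ B, ∑ b ∈ A with b ⊆ B.erase x,
        f b * (((B.erase x).card.choose b.card : ℕ) : ℝ)⁻¹ =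
      ∑ b ∈ A with b ⊂ B, ∑ x ∈ B \ b, f b * (((B.card - 1).choose b.card : ℕ) : ℝ)⁻¹ := by
    rw [Finset.sum_comm' (t' := {b ∈ A | b ⊂ B}) (s' := fun b => B \ b)]
    · refine Finset.sum_congr rfl fun b _ => Finset.sum_congr rfl fun x hx => ?_
      rw [Finset.card_erase_of_mem (Finset.mem_sdiff.1 hx).1]
    · intro x b
      simp only [Finset.mem_filter, Finset.mem_sdiff, Finset.subset_erase]
      constructor
      · rintro ⟨hx, hb, hbB, hxb⟩
        exact ⟨⟨hx, hxb⟩, hb, Finset.ssubset_iff_subset_ne.2 ⟨hbB, fun e => hxb (e ▸ hx)⟩⟩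
      · rintro ⟨⟨hx, hxb⟩, hb, hbB⟩
        exact ⟨hx, hb, hbB.1, hxb⟩
  rw [hswap, Finset.mul_sum]
  refine Finset.sum_congr rfl fun b hb => ?_
  have hbB := (Finset.mem_filter.1 hb).2
  rw [Finset.sum_const, Finset.card_sdiff_of_subset hbB.1, nsmul_eq_mul,
    inv_choose_eq_of_lt (Finset.card_lt_card hbB)]
  ring

/-- If a random maximal chain up to `B` meets `A` in `X` sets, the left side is the mean of `X - (X
choose 2)`, which never exceeds 1. In the induction, a top set `B ∈ A` contributes `1 - lymDegree A
B`, which offsets the rest; otherwise average over `B.erase x`. -/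
theorem sum_one_sub_lymDegree_le_one {α : Type*} [DecidableEq α] (A : Finset (Finset α))
    (B : Finset α) :
    ∑ b ∈ A with b ⊆ B, (1 - lymDegree A b) * ((B.card.choose b.card : ℕ) : ℝ)⁻¹ ≤ 1 := by
  induction B using Finset.strongInduction with
  | _ B ih =>
  by_cases hB : B ∈ A
  · have hset : ({b ∈ A | b ⊆ B} : Finset (Finset α)) = insert B {b ∈ A | b ⊂ B} := by
      ext b
      simp only [Finset.mem_filter, Finset.mem_insert]
      constructor
      · rintro ⟨hb, h⟩
        exact (eq_or_ssubset_of_subset h).imp_right fun h => ⟨hb, h⟩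
      · rintro (rfl | h)
        · exact ⟨hB, subset_rfl⟩
        · exact ⟨h.1, h.2.1⟩
    rw [hset, Finset.sum_insert (by simp)]
    have : ∑ b ∈ A with b ⊂ B, (1 - lymDegree A b) * ((B.card.choose b.card : ℕ) : ℝ)⁻¹ ≤
        lymDegree A B := by
      refine Finset.sum_le_sum fun b _ => mul_le_of_le_one_left (by positivity) ?_
      linarith [lymDegree_nonneg A b]
    simp only [Nat.choose_self, Nat.cast_one, inv_one, mul_one]
    linarith
  · have hset : ({b ∈ A | b ⊆ B} : Finset (Finset α)) = {b ∈ A | b ⊂ B} := by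
      refine Finset.filter_congr fun b hb => ?_
      rw [Finset.ssubset_iff_subset_ne]
      exact ⟨fun h => ⟨h, fun e => hB (e ▸ hb)⟩, fun h => h.1⟩
    rw [hset, sum_ssubset_div_choose_eq]
    calc _ ≤ (B.card : ℝ)⁻¹ * ∑ x ∈ B, (1 : ℝ) := by
          gcongr with x hx
          exact ih _ (Finset.erase_ssubset hx)
      _ ≤ 1 := by
          rw [Finset.sum_const, nsmul_eq_mul, mul_one]
          exact inv_mul_le_one

theorem exists_le_lymDegree {α : Type*} [DecidableEq α] [Fintype α] (A : Finset (Finset α)) {δ : ℝ}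
    (hδ : δ < 1)
    (hA : ((Fintype.card α).choose (Fintype.card α / 2) : ℕ) / (1 - δ) < A.card) :
    ∃ v ∈ A, δ ≤ lymDegree A v := by
  by_contra! h
  have hC : (0 : ℝ) < ((Fintype.card α).choose (Fintype.card α / 2) : ℕ) := by
    exact_mod_cast Nat.choose_pos (Nat.div_le_self _ _)
  have h1 := sum_one_sub_lymDegree_le_one A Finset.univ
  rw [Finset.filter_true_of_mem fun b _ => Finset.subset_univ b, Finset.card_univ] at h1
  have h2 : ∑ b ∈ A, (1 - δ) * (((Fintype.card α).choose (Fintype.card α / 2) : ℕ) : ℝ)⁻¹ ≤ 1 := by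
    refine le_trans (Finset.sum_le_sum fun b hb => ?_) h1
    have : (0 : ℝ) < ((Fintype.card α).choose b.card : ℕ) := by
      exact_mod_cast Nat.choose_pos (Finset.card_le_univ b)
    gcongr
    · linarith [h b hb]
    · exact (h b hb).le
    · exact Nat.choose_le_middle _ _
  rw [Finset.sum_const, nsmul_eq_mul, ← mul_assoc, ← div_eq_mul_inv, div_le_one hC] at h2
  rw [div_lt_iff₀ (by linarith)] at hA
  linarith

/-! ### Total capacity -/

/-- Telescoping: with `m = p + 2`, `1/(k choose m)` is `m/(m-1)` times the drop of `1/(j choose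
(m-1))` from `j = k - 1` to `j = k`. -/
theorem sum_Ioc_inv_choose (p d : ℕ) :
    ∑ k ∈ Finset.Ioc (p + 2) (p + 2 + d), ((k.choose (p + 2) : ℕ) : ℝ)⁻¹ =
      (p + 2) / (p + 1) * (1 / (p + 2) - (((p + 2 + d).choose (p + 1) : ℕ) : ℝ)⁻¹) := by
  induction d with
  | zero =>
    have : (p + 2).choose (p + 1) = p + 2 := Nat.choose_succ_self_right (p + 1)
    simp only [add_zero, Finset.Ioc_self, Finset.sum_empty, this]
    push_cast
    ring
  | succ d ih =>
    rw [← add_assoc, Finset.sum_Ioc_succ_top (by omega), ih]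
    have h1 : ((p + 2 + d + 1 : ℕ) : ℝ) * ((p + 2 + d).choose (p + 1) : ℕ) =
        ((p + 2 + d + 1).choose (p + 2) : ℕ) * ((p + 2 : ℕ) : ℝ) := by
      exact_mod_cast Nat.add_one_mul_choose_eq (p + 2 + d) (p + 1)
    have h2 : ((p + 2 + d).choose (p + 1) : ℕ) * ((p + 2 + d + 1 : ℕ) : ℝ) =
        ((p + 2 + d + 1).choose (p + 1) : ℕ) * ((d + 2 : ℕ) : ℝ) := by
      have := Nat.choose_mul_succ_eq (p + 2 + d) (p + 1)
      rw [show p + 2 + d + 1 - (p + 1) = d + 2 by omega] at this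
      exact_mod_cast this
    have h0 : (0 : ℝ) < ((p + 2 + d).choose (p + 1) : ℕ) := by
      exact_mod_cast Nat.choose_pos (by omega)
    set C : ℝ := (((p + 2 + d).choose (p + 1) : ℕ) : ℝ)
    have h3 : (((p + 2 + d + 1).choose (p + 2) : ℕ) : ℝ) = (p + 2 + d + 1) * C / (p + 2) := by
      rw [eq_div_iff (by positivity)]; push_cast at h1; linarith
    have h4 : (((p + 2 + d + 1).choose (p + 1) : ℕ) : ℝ) = (p + 2 + d + 1) * C / (d + 2) := by
      rw [eq_div_iff (by positivity)]; push_cast at h2; linarith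
    rw [h3, h4]
    field_simp
    ring

theorem sum_Ioc_inv_choose_le_card (m n : ℕ) :
    ∑ k ∈ Finset.Ioc m n, ((k.choose m : ℕ) : ℝ)⁻¹ ≤ n := by
  calc _ ≤ ∑ k ∈ Finset.Ioc m n, (1 : ℝ) := by
        refine Finset.sum_le_sum fun k hk => inv_le_one_of_one_le₀ ?_
        exact_mod_cast Nat.choose_pos (Finset.mem_Ioc.1 hk).1.le
    _ ≤ n := by
        rw [Finset.sum_const, nsmul_eq_mul, mul_one, Nat.card_Ioc]
        exact_mod_cast Nat.sub_le _ _

theorem sum_Ioc_inv_choose_le {m n : ℕ} (hm : 2 ≤ m) (hmn : m ≤ n) :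
    ∑ k ∈ Finset.Ioc m n, ((k.choose m : ℕ) : ℝ)⁻¹ ≤ 3 / (m + 1) := by
  obtain ⟨p, rfl⟩ : ∃ p, m = p + 2 := ⟨m - 2, by omega⟩
  obtain ⟨d, rfl⟩ := Nat.exists_eq_add_of_le hmn
  rw [sum_Ioc_inv_choose]
  calc _ ≤ ((p : ℝ) + 2) / (p + 1) * (1 / (p + 2)) := by
        gcongr
        exact sub_le_self _ (by positivity)
    _ = 1 / (p + 1) := by field_simp
    _ ≤ _ := by
        push_cast
        rw [div_le_div_iff₀ (by positivity) (by positivity)]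
        have : (0 : ℝ) ≤ p := Nat.cast_nonneg p
        linarith

theorem mul_add_one_sq_le_two_pow (n : ℕ) : (n + n ^ 2) * (n + 1) ≤ 8 * 2 ^ n := by
  rcases le_or_gt n 4 with h | h
  · interval_cases n <;> norm_num
  · induction n, h.le using Nat.le_induction with
    | base => norm_num
    | succ n hn ih =>
      rcases hn.eq_or_lt with rfl | hn'
      · norm_num
      · have := ih hn'
        obtain ⟨k, rfl⟩ := Nat.exists_eq_add_of_le hn
        rw [pow_succ 2]
        nlinarith [Nat.zero_le ((k + 5) * (k ^ 2 + 6 * k + 4))]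

theorem sum_sum_Ioc_inv_choose_le (n : ℕ) :
    ∑ a : Finset (Fin n), ∑ k ∈ Finset.Ioc a.card n, ((k.choose a.card : ℕ) : ℝ)⁻¹ ≤
      14 * 2 ^ n / (n + 1) := by
  rw [← Finset.powerset_univ, Finset.sum_powerset_apply_card
    (fun m => ∑ k ∈ Finset.Ioc m n, ((k.choose m : ℕ) : ℝ)⁻¹), Finset.card_univ, Fintype.card_fin]
  -- For `m ≥ 2`, `(n choose m)/(m+1)` is `((n+1) choose (m+1))/(n+1)`. Levels 0 and 1, where the
  -- telescoped bound fails, get the crude bounds `n` and `n ^ 2`.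
  have hterm : ∀ m ∈ Finset.range (n + 1),
      n.choose m • ∑ k ∈ Finset.Ioc m n, ((k.choose m : ℕ) : ℝ)⁻¹ ≤
      3 / (n + 1) * (((n + 1).choose (m + 1) : ℕ) : ℝ) + (if m = 0 then (n : ℝ) else 0) +
        (if m = 1 then (n : ℝ) ^ 2 else 0) := by
    intro m hm
    rw [nsmul_eq_mul]
    have h3 : (0 : ℝ) ≤ 3 / (n + 1) * (((n + 1).choose (m + 1) : ℕ) : ℝ) := by positivity
    have hle := sum_Ioc_inv_choose_le_card m n
    rcases m with _ | _ | m
    · simp only [Nat.choose_zero_right, Nat.cast_one, one_mul, if_true] at hle ⊢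
      rw [if_neg zero_ne_one]
      linarith
    · simp only [zero_add, Nat.choose_one_right, one_ne_zero, if_false, if_true, add_zero] at hle h3 ⊢
      nlinarith [Nat.cast_nonneg (α := ℝ) n]
    · have hmn : m + 2 ≤ n := by have := Finset.mem_range.1 hm; omega
      have h := sum_Ioc_inv_choose_le (by omega : 2 ≤ m + 2) hmn
      have h1 : ((n + 1 : ℕ) : ℝ) * (n.choose (m + 2) : ℕ) =
          ((n + 1).choose (m + 2 + 1) : ℕ) * ((m + 2 + 1 : ℕ) : ℝ) := by
        exact_mod_cast Nat.add_one_mul_choose_eq n (m + 2)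
      have h2 : ((n.choose (m + 2) : ℕ) : ℝ) * (3 / (((m + 2 : ℕ) : ℝ) + 1)) =
          3 / (n + 1) * (((n + 1).choose (m + 2 + 1) : ℕ) : ℝ) := by
        push_cast at h1 ⊢
        field_simp
        linarith
      rw [if_neg (by omega), if_neg (by omega), add_zero, add_zero, ← h2]
      exact mul_le_mul_of_nonneg_left h (Nat.cast_nonneg _)
  refine (Finset.sum_le_sum hterm).trans ?_
  rw [Finset.sum_add_distrib, Finset.sum_add_distrib, ← Finset.mul_sum]
  have hA : ∑ m ∈ Finset.range (n + 1), (((n + 1).choose (m + 1) : ℕ) : ℝ) ≤ 2 * 2 ^ n := by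
    have := Nat.sum_range_choose (n + 1)
    rw [Finset.sum_range_succ'] at this
    have h2 : ∑ m ∈ Finset.range (n + 1), (n + 1).choose (m + 1) ≤ 2 * 2 ^ n := by
      rw [pow_succ] at this; omega
    exact_mod_cast h2
  have hB : ∑ m ∈ Finset.range (n + 1), (if m = 0 then (n : ℝ) else 0) ≤ n := by
    rw [Finset.sum_ite_eq']; split_ifs <;> simp
  have hC : ∑ m ∈ Finset.range (n + 1), (if m = 1 then (n : ℝ) ^ 2 else 0) ≤ (n : ℝ) ^ 2 := by
    rw [Finset.sum_ite_eq']; split_ifs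
    · exact le_rfl
    · positivity
  have hD : ((n : ℝ) + n ^ 2) ≤ 8 * 2 ^ n / (n + 1) := by
    rw [le_div_iff₀ (by positivity)]
    exact_mod_cast mul_add_one_sq_le_two_pow n
  have hE : 3 / ((n : ℝ) + 1) * ∑ m ∈ Finset.range (n + 1), (((n + 1).choose (m + 1) : ℕ) : ℝ) ≤
      3 / ((n : ℝ) + 1) * (2 * 2 ^ n) := by gcongr
  have hF : 3 / ((n : ℝ) + 1) * (2 * 2 ^ n) + 8 * 2 ^ n / (n + 1) = 14 * 2 ^ n / (n + 1) := by ring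
  linarith

/-! ### Counting sparse families -/

/-- Every member of `F` has fewer than `r` strict supersets in `F` of each size. -/
def UpSparse {α : Type*} [DecidableEq α] (r : ℕ) (F : Finset (Finset α)) : Prop :=
  ∀ a ∈ F, ∀ k, ({b ∈ F | a ⊂ b ∧ b.card = k} : Finset (Finset α)).card < r

theorem UpSparse.sum_le {n r : ℕ} {F : Finset (Finset (Fin n))} (hF : UpSparse r F)
    {a : Finset (Fin n)} (ha : a ∈ F) :
    ∑ b ∈ F, (if a ⊂ b then ((b.card.choose a.card : ℕ) : ℝ)⁻¹ else 0) ≤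
      r * ∑ k ∈ Finset.Ioc a.card n, ((k.choose a.card : ℕ) : ℝ)⁻¹ := by
  rw [← Finset.sum_filter, ← Finset.sum_fiberwise_of_maps_to (g := Finset.card)
    (t := Finset.Ioc a.card n), Finset.mul_sum]
  · refine Finset.sum_le_sum fun k _ => ?_
    rw [Finset.filter_filter]
    calc _ = ∑ b ∈ F with a ⊂ b ∧ b.card = k, ((k.choose a.card : ℕ) : ℝ)⁻¹ :=
          Finset.sum_congr rfl fun b hb => by rw [(Finset.mem_filter.1 hb).2.2]
      _ ≤ _ := by
          rw [Finset.sum_const, nsmul_eq_mul]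
          gcongr
          exact (hF a ha k).le
  · intro b hb
    exact Finset.mem_Ioc.2 ⟨Finset.card_lt_card (Finset.mem_filter.1 hb).2,
      (Finset.card_le_univ b).trans_eq (Fintype.card_fin n)⟩

theorem card_upSparse_le {n r : ℕ} (hn : 1 ≤ n) (hr : 1 ≤ r) {δ : ℝ} (hδ0 : 0 < δ) (hδ1 : δ < 1)
    (S : Finset (Finset (Finset (Fin n)))) (hS : ∀ F ∈ S, UpSparse r F) :
    (S.card : ℝ) ≤ (1 + (n : ℝ)⁻¹) ^ (2 ^ n) * (n : ℝ) ^ (2 * (r * (14 * 2 ^ n / (n + 1))) / δ) *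
      (2 : ℝ) ^ ((n.choose (n / 2) : ℕ) / (1 - δ)) := by
  have hn' : (1 : ℝ) ≤ n := by exact_mod_cast hn
  have hr' : (1 : ℝ) ≤ r := by exact_mod_cast hr
  have key := card_le_of_weight (V := Finset (Fin n))
    (fun b a => if a ⊂ b then ((b.card.choose a.card : ℕ) : ℝ)⁻¹ else 0)
    (fun a => r * ∑ k ∈ Finset.Ioc a.card n, ((k.choose a.card : ℕ) : ℝ)⁻¹)
    (fun b a => by split_ifs <;> positivity)
    (fun b a => by
      split_ifs with h
      · refine le_trans ?_ (le_mul_of_one_le_left (Finset.sum_nonneg fun _ _ => by positivity) hr')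
        exact Finset.single_le_sum (f := fun k => ((k.choose a.card : ℕ) : ℝ)⁻¹)
          (fun _ _ => by positivity) (Finset.mem_Ioc.2 ⟨Finset.card_lt_card h,
            (Finset.card_le_univ b).trans_eq (Fintype.card_fin n)⟩)
      · positivity)
    S (fun F hF a ha => (hS F hF).sum_le ha) (M := (n.choose (n / 2) : ℕ) / (1 - δ)) hδ0 hn'
    (fun A hA => by
      have := exists_le_lymDegree A hδ1 (by rwa [Fintype.card_fin])
      simpa only [lymDegree, Finset.sum_filter] using this)
  rw [Fintype.card_finset, Fintype.card_fin, ← Finset.mul_sum] at key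
  refine key.trans ?_
  gcongr
  exact sum_sum_Ioc_inv_choose_le n

/-! ### Size of the middle layer and the asymptotic count -/

theorem sixteen_pow_le_centralBinom_sq (m : ℕ) :
    16 ^ (m + 1) ≤ 4 * (m + 1) * (m + 1).centralBinom ^ 2 := by
  induction m with
  | zero => simp [Nat.centralBinom]
  | succ m ih =>
    have h := Nat.succ_mul_centralBinom_succ (m + 1)
    set c := (m + 1).centralBinom
    set d := (m + 1 + 1).centralBinom
    have h2 : (m + 2) ^ 2 * d ^ 2 = 4 * (2 * m + 3) ^ 2 * c ^ 2 := by
      calc _ = ((m + 1 + 1) * d) ^ 2 := by ring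
        _ = _ := by rw [h]; ring
    refine le_of_mul_le_mul_left ?_ (by omega : 0 < m + 2)
    calc (m + 2) * 16 ^ (m + 1 + 1) = 16 * (m + 2) * 16 ^ (m + 1) := by ring
      _ ≤ 16 * (m + 2) * (4 * (m + 1) * c ^ 2) := by gcongr
      _ ≤ 4 * (4 * (2 * m + 3) ^ 2 * c ^ 2) := by nlinarith [sq_nonneg c]
      _ = (m + 2) * (4 * (m + 1 + 1) * d ^ 2) := by rw [← h2]; ring

theorem four_pow_le_choose_middle_sq {n : ℕ} (hn : 1 ≤ n) :
    4 ^ n ≤ 4 * n * (n.choose (n / 2)) ^ 2 := by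
  rcases Nat.even_or_odd' n with ⟨m, rfl | rfl⟩
  · obtain ⟨m, rfl⟩ : ∃ j, m = j + 1 := ⟨m - 1, by omega⟩
    have := sixteen_pow_le_centralBinom_sq m
    rw [Nat.centralBinom] at this
    rw [Nat.mul_div_cancel_left _ two_pos, pow_mul]
    refine (by norm_num : (4 ^ 2) ^ (m + 1) = 16 ^ (m + 1)).trans_le (this.trans ?_)
    gcongr
    omega
  · have := sixteen_pow_le_centralBinom_sq m
    have h2 : (m + 1).centralBinom = 2 * (2 * m + 1).choose m := by
      rw [Nat.centralBinom, show 2 * (m + 1) = 2 * m + 1 + 1 by ring, Nat.choose_succ_succ,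
        Nat.choose_symm_half]
      ring
    rw [show (2 * m + 1) / 2 = m by omega]
    rw [h2] at this
    have h3 : (16 : ℕ) ^ (m + 1) = 4 * 4 ^ (2 * m + 1) := by
      rw [pow_succ, pow_succ, pow_mul]; norm_num; ring
    nlinarith [Nat.zero_le (m * (2 * m + 1).choose m ^ 2)]

theorem two_pow_le_sqrt_mul_choose_middle {n : ℕ} (hn : 1 ≤ n) :
    (2 : ℝ) ^ n ≤ 2 * √n * (n.choose (n / 2) : ℕ) := by
  refine le_of_sq_le_sq ?_ (by positivity)
  rw [mul_pow, mul_pow, Real.sq_sqrt (Nat.cast_nonneg n), ← pow_mul, mul_comm n, pow_mul]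
  have := four_pow_le_choose_middle_sq hn
  norm_num
  exact_mod_cast this

theorem eventually_card_upSparse_le {r : ℕ} (hr : 1 ≤ r) {ε : ℝ} (hε : 0 < ε) :
    ∀ᶠ n : ℕ in atTop, ∀ S : Finset (Finset (Finset (Fin n))), (∀ F ∈ S, UpSparse r F) →
      (S.card : ℝ) ≤ (2 : ℝ) ^ ((1 + ε) * ((n.choose (n / 2) : ℕ) : ℝ)) := by
  obtain ⟨δ, hδ0, hδ1, hδ⟩ : ∃ δ : ℝ, 0 < δ ∧ δ < 1 ∧ 1 / (1 - δ) = 1 + ε / 2 :=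
    ⟨1 - 1 / (1 + ε / 2), by rw [sub_pos, div_lt_one (by positivity)]; linarith,
      sub_lt_self _ (by positivity), by field_simp; ring⟩
  have hlog2 : 0 < Real.log 2 := Real.log_pos one_lt_two
  set K : ℝ := 2 + 56 * r / δ with hK
  have hKpos : 0 < K := by positivity
  have hlim : ∀ᶠ n : ℕ in atTop, K * (Real.log n / √n) ≤ Real.log 2 * (ε / 2) := by
    have h := (isLittleO_log_rpow_atTop (r := 1 / 2) (by norm_num)).tendsto_div_nhds_zero.comp
      tendsto_natCast_atTop_atTop
    have h2 := (h.const_mul K).eventually (Iic_mem_nhds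
      (by rw [mul_zero]; positivity : K * 0 < Real.log 2 * (ε / 2)))
    filter_upwards [h2] with n hn
    simpa [Real.sqrt_eq_rpow] using hn
  filter_upwards [hlim, eventually_ge_atTop 3] with n hn hn3 S hS
  have hn1 : (3 : ℝ) ≤ n := by exact_mod_cast hn3
  have hn0 : (0 : ℝ) < n := by linarith
  have hsq : 0 < √(n : ℝ) := Real.sqrt_pos.2 hn0
  have hsqq : √(n : ℝ) * √n = n := Real.mul_self_sqrt hn0.le
  have hinv : (n : ℝ)⁻¹ = (√(n : ℝ))⁻¹ * (√(n : ℝ))⁻¹ := by rw [← mul_inv, hsqq]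
  -- This lets the `1 / √n` from the factor `(1 + 1/n) ^ (2 ^ n)` be absorbed into `log n / √n`.
  have hlogn : 1 ≤ Real.log n := by
    rw [Real.le_log_iff_exp_le hn0]
    linarith [Real.exp_one_lt_d9]
  refine (card_upSparse_le (by omega) hr hδ0 hδ1 S hS).trans ?_
  set C : ℝ := ((n.choose (n / 2) : ℕ) : ℝ) with hC
  have hC0 : 0 ≤ C := Nat.cast_nonneg _
  have h2n : (2 : ℝ) ^ n ≤ 2 * √n * C := two_pow_le_sqrt_mul_choose_middle (by omega)
  rw [← Real.log_le_log_iff (by positivity) (by positivity),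
    Real.log_mul (by positivity) (by positivity), Real.log_mul (by positivity) (by positivity),
    Real.log_pow, Real.log_rpow hn0, Real.log_rpow two_pos, Real.log_rpow two_pos]
  have e1 : ((2 ^ n : ℕ) : ℝ) * Real.log (1 + (n : ℝ)⁻¹) ≤ 2 * (Real.log n / √n) * C := by
    have hl : Real.log (1 + (n : ℝ)⁻¹) ≤ (n : ℝ)⁻¹ := by
      have := Real.log_le_sub_one_of_pos (by positivity : 0 < 1 + (n : ℝ)⁻¹)
      linarith
    calc _ ≤ (2 * √n * C) * (n : ℝ)⁻¹ := by
          push_cast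
          refine mul_le_mul h2n hl (Real.log_nonneg ?_) (by positivity)
          linarith [inv_pos.2 hn0]
      _ = 2 * (1 / √n) * C := by rw [hinv]; field_simp
      _ ≤ _ := by gcongr
  have e2 : 2 * (r * (14 * 2 ^ n / ((n : ℝ) + 1))) / δ * Real.log n ≤
      56 * r / δ * (Real.log n / √n) * C := by
    calc _ ≤ 2 * (r * (14 * (2 * √n * C) / n)) / δ * Real.log n := by
          gcongr
          linarith
      _ = _ := by rw [div_eq_mul_inv _ (n : ℝ), hinv]; field_simp; ring
  have e3 : C / (1 - δ) = (1 + ε / 2) * C := by rw [← hδ]; ring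
  have e4 := mul_le_mul_of_nonneg_right hn hC0
  rw [e3]
  have e5 : K * (Real.log n / √n) * C =
    2 * (Real.log n / √n) * C + 56 * r / δ * (Real.log n / √n) * C := by rw [hK]; ring
  nlinarith

/-! ### From forbidden posets to sparsity -/

theorem isInducedFree_iff {P : Type*} [PartialOrder P] [Finite P] {n : ℕ}
    {F : Finset (Finset (Fin n))} :
    IsInducedFree P F ↔ ∀ f : P → Finset (Fin n), (∀ p q, p ≤ q ↔ f p ⊆ f q) → ∃ p, f p ∉ F := by
  classical
  have := Fintype.ofFinite P
  constructor
  · intro h f hf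
    by_contra! hF
    have hinj : Function.Injective f := fun p q e =>
      le_antisymm ((hf p q).2 e.le) ((hf q p).2 e.ge)
    refine h (Finset.univ.image f) (by simpa [Finset.image_subset_iff] using hF) ?_
    refine ⟨Equiv.ofBijective (fun p => ⟨f p, Finset.mem_image_of_mem _ (Finset.mem_univ _)⟩)
      ⟨fun p q e => hinj (congrArg Subtype.val e), ?_⟩, hf⟩
    rintro ⟨A, hA⟩
    obtain ⟨p, -, rfl⟩ := Finset.mem_image.1 hA
    exact ⟨p, rfl⟩
  · rintro h G hG ⟨i, hi⟩
    obtain ⟨p, hp⟩ := h (fun p => (i p).1) hi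
    exact hp (hG (i p).2)

instance {l : ℕ} (r : Fin l → ℕ) : Finite (MultipartitePoset r) :=
  Finite.of_injective (fun a => (⟨a.part, a.index⟩ : Σ i, Fin (r i))) fun a b h => by
    cases a; cases b; simpa using h

/-- A family with `r i` members of a given size in part `i`, each member of a part containing every
member of the earlier parts, yields an induced copy of the complete multipartite poset. -/
theorem not_isInducedFree_of_layers {l n : ℕ} {r : Fin l → ℕ} {F : Finset (Finset (Fin n))}
    (G : Fin l → Finset (Finset (Fin n))) (hGF : ∀ i, G i ⊆ F) (hr : ∀ i, r i ≤ (G i).card)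
    (hanti : ∀ i, ∀ a ∈ G i, ∀ b ∈ G i, a ⊆ b → a = b)
    (hlt : ∀ i j, i < j → ∀ a ∈ G i, ∀ b ∈ G j, a ⊂ b) :
    ¬ IsInducedFree (MultipartitePoset r) F := by
  have hf : ∀ i, ∃ f : Fin (r i) → Finset (Fin n), Function.Injective f ∧ ∀ j, f j ∈ G i := by
    intro i
    obtain ⟨H, hHG, hH⟩ := Finset.exists_subset_card_eq (hr i)
    exact ⟨fun j => (H.equivFinOfCardEq hH).symm j,
      Subtype.val_injective.comp (Equiv.injective _), fun j => hHG (Subtype.prop _)⟩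
  choose f hinj hmem using hf
  rw [isInducedFree_iff]
  push Not
  refine ⟨fun p => f p.part p.index, ?_, fun p => hGF _ (hmem _ _)⟩
  rintro ⟨i, a⟩ ⟨j, b⟩
  constructor
  · rintro (h | h)
    · rw [h]
    · exact (hlt _ _ h _ (hmem _ _) _ (hmem _ _)).1
  · intro h
    rcases lt_trichotomy i j with hij | rfl | hij
    · exact Or.inr hij
    · refine Or.inl ?_
      have hab : a = b := hinj i (hanti i _ (hmem _ _) _ (hmem _ _) h)
      rw [hab]
    · exact absurd h (hlt _ _ hij _ (hmem _ _) _ (hmem _ _)).2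

theorem IsInducedFree.upSparse {n r : ℕ} {F : Finset (Finset (Fin n))}
    (hF : IsInducedFree (VeePoset r) F) : UpSparse r F := by
  intro a ha k
  by_contra! h
  refine not_isInducedFree_of_layers (r := ![1, r]) (F := F)
    ![{a}, {b ∈ F | a ⊂ b ∧ b.card = k}] ?_ ?_ ?_ ?_ hF
  · intro i
    fin_cases i
    · simpa using ha
    · exact Finset.filter_subset _ _
  · intro i
    fin_cases i
    · simp
    · exact h
  · intro i
    fin_cases i
    · simp
    · intro b hb c hc hbc
      have h1 := (Finset.mem_filter.1 hb).2.2
      have h2 := (Finset.mem_filter.1 hc).2.2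
      exact Finset.eq_of_subset_of_card_le hbc (by omega)
  · intro i j hij
    fin_cases i <;> fin_cases j <;> simp at hij ⊢
    tauto

/-- Every member of `F` has fewer than `r` strict subsets in `F` of each size. -/
def DownSparse {α : Type*} [DecidableEq α] (r : ℕ) (F : Finset (Finset α)) : Prop :=
  ∀ a ∈ F, ∀ k, ({b ∈ F | b ⊂ a ∧ b.card = k} : Finset (Finset α)).card < r

theorem DownSparse.upSparse_compls {α : Type*} [DecidableEq α] [Fintype α] {r : ℕ}
    {F : Finset (Finset α)} (hF : DownSparse r F) : UpSparse r (F.image compl) := by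
  intro a' ha' k
  obtain ⟨a, ha, rfl⟩ := Finset.mem_image.1 ha'
  refine lt_of_le_of_lt (Finset.card_le_card_of_injOn compl ?_ compl_injective.injOn)
    (hF a ha (Fintype.card α - k))
  intro b' hb'
  obtain ⟨hmem, hab, rfl⟩ := Finset.mem_filter.1 hb'
  obtain ⟨b, hb, rfl⟩ := Finset.mem_image.1 hmem
  simp only [Finset.coe_filter, Set.mem_ofPred_eq, compl_compl]
  refine ⟨hb, compl_lt_compl_iff_lt.1 hab, ?_⟩
  rw [← Finset.card_compl, compl_compl]

/-- A member with `t` supersets of one size and `s` subsets of one size would be the middle of an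
induced `K_{s,1,t}`. -/
theorem IsInducedFree.exists_union {n s t : ℕ} {F : Finset (Finset (Fin n))}
    (hF : IsInducedFree (KPoset s t) F) :
    ∃ U D : Finset (Finset (Fin n)), UpSparse t U ∧ DownSparse s D ∧ U ∪ D = F := by
  classical
  refine ⟨{a ∈ F | ∀ k, ({b ∈ F | a ⊂ b ∧ b.card = k} : Finset (Finset (Fin n))).card < t},
    {a ∈ F | ∀ k, ({b ∈ F | b ⊂ a ∧ b.card = k} : Finset (Finset (Fin n))).card < s}, ?_, ?_, ?_⟩
  · intro a ha k
    exact (Finset.card_le_card (Finset.filter_subset_filter _ (Finset.filter_subset _ _))).trans_lt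
      ((Finset.mem_filter.1 ha).2 k)
  · intro a ha k
    exact (Finset.card_le_card (Finset.filter_subset_filter _ (Finset.filter_subset _ _))).trans_lt
      ((Finset.mem_filter.1 ha).2 k)
  · rw [← Finset.filter_or, Finset.filter_eq_self]
    intro a ha
    by_contra! h
    obtain ⟨⟨k, hk⟩, m, hm⟩ := h
    refine not_isInducedFree_of_layers (r := ![s, 1, t]) (F := F)
      ![{b ∈ F | b ⊂ a ∧ b.card = m}, {a}, {b ∈ F | a ⊂ b ∧ b.card = k}] ?_ ?_ ?_ ?_ hF
    · intro i
      fin_cases i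
      · exact Finset.filter_subset _ _
      · simpa using ha
      · exact Finset.filter_subset _ _
    · intro i
      fin_cases i
      · exact hm
      · simp
      · exact hk
    · intro i
      fin_cases i
      · intro b hb c hc hbc
        have h1 := (Finset.mem_filter.1 hb).2.2
        have h2 := (Finset.mem_filter.1 hc).2.2
        exact Finset.eq_of_subset_of_card_le hbc (by omega)
      · simp
      · intro b hb c hc hbc
        have h1 := (Finset.mem_filter.1 hb).2.2
        have h2 := (Finset.mem_filter.1 hc).2.2
        exact Finset.eq_of_subset_of_card_le hbc (by omega)
    · intro i j hij
      fin_cases i <;> fin_cases j <;> simp at hij ⊢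
      · tauto
      · intro b _ hb _ c _ hc _
        exact hb.trans hc
      · tauto

/-! ### Upper and lower bounds for the counts -/

/-- The induced `P`-free families, as a finset. -/
noncomputable def inducedFreeFamilies (P : Type*) [PartialOrder P] (n : ℕ) :
    Finset (Finset (Finset (Fin n))) :=
  open Classical in {F | IsInducedFree P F}

theorem numInducedFree_eq_card (P : Type*) [PartialOrder P] (n : ℕ) :
    numInducedFree P n = (inducedFreeFamilies P n).card := by
  classical
  rw [numInducedFree, Nat.card_eq_fintype_card, Fintype.card_subtype, inducedFreeFamilies]

theorem mem_inducedFreeFamilies {P : Type*} [PartialOrder P] {n : ℕ} {F : Finset (Finset (Fin n))} :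
    F ∈ inducedFreeFamilies P n ↔ IsInducedFree P F := by
  simp [inducedFreeFamilies]

theorem two_pow_le_numInducedFree {P : Type*} [PartialOrder P] {n : ℕ}
    (L : Finset (Finset (Fin n))) (hL : IsInducedFree P L) :
    2 ^ L.card ≤ numInducedFree P n := by
  rw [numInducedFree_eq_card, ← Finset.card_powerset]
  exact Finset.card_le_card fun F hF => mem_inducedFreeFamilies.2 fun G hG =>
    hL G (hG.trans (Finset.mem_powerset.1 hF))

theorem eventually_numInducedFree_vee_le {r : ℕ} (hr : 1 ≤ r) {ε : ℝ} (hε : 0 < ε) :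
    ∀ᶠ n : ℕ in atTop, (numInducedFree (VeePoset r) n : ℝ) ≤
      (2 : ℝ) ^ ((1 + ε) * ((n.choose (n / 2) : ℕ) : ℝ)) := by
  filter_upwards [eventually_card_upSparse_le hr hε] with n hn
  rw [numInducedFree_eq_card]
  exact hn _ fun F hF => (mem_inducedFreeFamilies.1 hF).upSparse

theorem eventually_numInducedFree_K_le {s t : ℕ} (hs : 1 ≤ s) (ht : 1 ≤ t) {ε : ℝ} (hε : 0 < ε) :
    ∀ᶠ n : ℕ in atTop, (numInducedFree (KPoset s t) n : ℝ) ≤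
      (2 : ℝ) ^ ((2 + ε) * ((n.choose (n / 2) : ℕ) : ℝ)) := by
  classical
  filter_upwards [eventually_card_upSparse_le hs (half_pos hε),
    eventually_card_upSparse_le ht (half_pos hε)] with n hns hnt
  have h1 := hns {F | UpSparse s F} (fun F hF => (Finset.mem_filter.1 hF).2)
  have h2 := hnt {F | UpSparse t F} (fun F hF => (Finset.mem_filter.1 hF).2)
  have hsub : inducedFreeFamilies (KPoset s t) n ⊆
      (({F | UpSparse s F} : Finset (Finset (Finset (Fin n)))) ×ˢ
        ({F | UpSparse t F} : Finset (Finset (Finset (Fin n))))).image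
          (fun p => p.2 ∪ p.1.image compl) := by
    intro F hF
    obtain ⟨U, D, hU, hD, hUD⟩ := (mem_inducedFreeFamilies.1 hF).exists_union
    refine Finset.mem_image.2 ⟨(D.image compl, U), ?_, ?_⟩
    · exact Finset.mem_product.2 ⟨Finset.mem_filter.2 ⟨Finset.mem_univ _, hD.upSparse_compls⟩,
        Finset.mem_filter.2 ⟨Finset.mem_univ _, hU⟩⟩
    · simp only [Finset.image_image, compl_comp_compl, Finset.image_id, hUD]
  have hcard := (Finset.card_le_card hsub).trans Finset.card_image_le
  rw [Finset.card_product] at hcard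
  rw [numInducedFree_eq_card]
  refine ((Nat.cast_le (α := ℝ)).2 hcard).trans ?_
  rw [Nat.cast_mul]
  refine (mul_le_mul h1 h2 (Nat.cast_nonneg _) (by positivity)).trans_eq ?_
  rw [← Real.rpow_add two_pos]
  ring_nf

theorem isInducedFree_middle {n r : ℕ} (hr : 1 ≤ r) :
    IsInducedFree (VeePoset r) (Finset.powersetCard (n / 2) (Finset.univ : Finset (Fin n))) := by
  rw [isInducedFree_iff]
  intro f hf
  by_contra! h
  have hc := fun p => (Finset.mem_powersetCard.1 (h p)).2
  let p : VeePoset r := ⟨0, ⟨0, one_pos⟩⟩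
  let q : VeePoset r := ⟨1, ⟨0, hr⟩⟩
  have hpq : p < q := (Fin.zero_lt_one : (0 : Fin 2) < 1)
  have h1 : f p = f q := Finset.eq_of_subset_of_card_le ((hf p q).1 hpq.le) (by rw [hc, hc])
  exact hpq.not_ge ((hf q p).2 h1.ge)

theorem isInducedFree_two_middle {n s t : ℕ} (hs : 1 ≤ s) (ht : 1 ≤ t) :
    IsInducedFree (KPoset s t) (Finset.powersetCard (n / 2) (Finset.univ : Finset (Fin n)) ∪
      Finset.powersetCard (n / 2 + 1) (Finset.univ : Finset (Fin n))) := by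
  rw [isInducedFree_iff]
  intro f hf
  by_contra! h
  have hc : ∀ p, (f p).card = n / 2 ∨ (f p).card = n / 2 + 1 := fun p => by
    simpa [Finset.mem_powersetCard] using h p
  have hlt : ∀ p q, p < q → (f p).card < (f q).card := fun p q hpq =>
    Finset.card_lt_card ⟨(hf p q).1 hpq.le, fun h => hpq.not_ge ((hf q p).2 h)⟩
  let p : KPoset s t := ⟨0, ⟨0, hs⟩⟩
  let q : KPoset s t := ⟨1, ⟨0, one_pos⟩⟩
  let u : KPoset s t := ⟨2, ⟨0, ht⟩⟩
  have h1 := hlt p q (by decide : (0 : Fin 3) < 1)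
  have h2 := hlt q u (by decide : (1 : Fin 3) < 2)
  have := hc p
  have := hc u
  omega

theorem two_pow_le_numInducedFree_vee {n r : ℕ} (hr : 1 ≤ r) :
    2 ^ (n.choose (n / 2)) ≤ numInducedFree (VeePoset r) n := by
  simpa using two_pow_le_numInducedFree _ (isInducedFree_middle (n := n) hr)

theorem two_pow_le_numInducedFree_K {n s t : ℕ} (hs : 1 ≤ s) (ht : 1 ≤ t) :
    2 ^ (n.choose (n / 2) + n.choose (n / 2 + 1)) ≤ numInducedFree (KPoset s t) n := by
  have h := two_pow_le_numInducedFree _ (isInducedFree_two_middle (n := n) hs ht)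
  rw [Finset.card_union_of_disjoint] at h
  · simpa using h
  · rw [Finset.disjoint_left]
    intro a ha hb
    have := (Finset.mem_powersetCard.1 ha).2
    have := (Finset.mem_powersetCard.1 hb).2
    omega

/-- With `k = n / 2`, the ratio of consecutive coefficients is `(n - k)/(k + 1) ≥ k/(k + 1)`, which
tends to 1. -/
theorem eventually_mul_choose_middle_le {ε : ℝ} (hε : 0 < ε) :
    ∀ᶠ n : ℕ in atTop, (1 - ε) * ((n.choose (n / 2) : ℕ) : ℝ) ≤ ((n.choose (n / 2 + 1) : ℕ) : ℝ) := by
  obtain ⟨N, hN⟩ := exists_nat_gt (1 / ε)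
  filter_upwards [eventually_ge_atTop (2 * N)] with n hn
  have h := Nat.choose_succ_right_eq n (n / 2)
  have hk : N ≤ n / 2 := by omega
  have h2 : n.choose (n / 2) * (n / 2) ≤ n.choose (n / 2 + 1) * (n / 2 + 1) := by
    rw [h]
    exact Nat.mul_le_mul_left _ (by omega)
  have h3 : ((n.choose (n / 2) : ℕ) : ℝ) * ((n / 2 : ℕ) : ℝ) ≤
      ((n.choose (n / 2 + 1) : ℕ) : ℝ) * (((n / 2 : ℕ) : ℝ) + 1) := by exact_mod_cast h2
  have hk' : (N : ℝ) ≤ ((n / 2 : ℕ) : ℝ) := by exact_mod_cast hk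
  set k : ℝ := ((n / 2 : ℕ) : ℝ)
  have hk0 : 0 ≤ k := Nat.cast_nonneg _
  have hεk : 1 ≤ ε * k := by
    rw [div_lt_iff₀ hε] at hN
    nlinarith
  have hC : (0 : ℝ) ≤ ((n.choose (n / 2) : ℕ) : ℝ) := Nat.cast_nonneg _
  refine le_of_mul_le_mul_right (le_trans ?_ h3) (by linarith : 0 < k + 1)
  nlinarith [mul_nonneg hC hε.le, mul_nonneg hC (sub_nonneg.2 hεk)]

theorem exists_tendsto_zero_of_bounds {N : ℕ → ℕ} {C : ℕ → ℝ} {a : ℝ} (hN : ∀ n, 0 < N n)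
    (hC : ∀ n, 0 < C n)
    (hlow : ∀ ε > 0, ∀ᶠ n in atTop, (2 : ℝ) ^ ((a - ε) * C n) ≤ N n)
    (hup : ∀ ε > 0, ∀ᶠ n in atTop, (N n : ℝ) ≤ (2 : ℝ) ^ ((a + ε) * C n)) :
    ∃ ε : ℕ → ℝ, Tendsto ε atTop (𝓝 0) ∧ ∀ n, (N n : ℝ) = (2 : ℝ) ^ ((a + ε n) * C n) := by
  have hN' : ∀ n, (0 : ℝ) < N n := fun n => Nat.cast_pos.2 (hN n)
  -- The error is obtained by solving the desired equality for `ε n`.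
  refine ⟨fun n => Real.logb 2 (N n) / C n - a, ?_, fun n => ?_⟩
  · rw [Metric.tendsto_nhds]
    intro ε hε
    filter_upwards [hlow (ε / 2) (half_pos hε), hup (ε / 2) (half_pos hε)] with n h1 h2
    rw [← Real.le_logb_iff_rpow_le one_lt_two (hN' n), ← le_div_iff₀ (hC n)] at h1
    rw [← Real.logb_le_iff_le_rpow one_lt_two (hN' n), ← div_le_iff₀ (hC n)] at h2
    rw [Real.dist_eq, sub_zero, abs_lt]
    constructor <;> linarith
  · rw [add_sub_cancel, div_mul_cancel₀ _ (hC n).ne',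
      Real.rpow_logb two_pos (by norm_num) (hN' n)]

theorem mainTheorem1 :
    (∀ r : ℕ, 1 ≤ r → ∃ ε : ℕ → ℝ, Tendsto ε atTop (𝓝 0) ∧
      ∀ n : ℕ, (numInducedFree (VeePoset r) n : ℝ) =
        (2 : ℝ) ^ ((1 + ε n) * ((n.choose (n / 2) : ℕ) : ℝ))) ∧
    (∀ s t : ℕ, 1 ≤ s → 1 ≤ t → ∃ ε : ℕ → ℝ, Tendsto ε atTop (𝓝 0) ∧
      ∀ n : ℕ, (numInducedFree (KPoset s t) n : ℝ) =
        (2 : ℝ) ^ ((2 + ε n) * ((n.choose (n / 2) : ℕ) : ℝ))) := by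
  have hC : ∀ n : ℕ, (0 : ℝ) < ((n.choose (n / 2) : ℕ) : ℝ) := fun n => by
    exact_mod_cast Nat.choose_pos (Nat.div_le_self _ _)
  refine ⟨fun r hr => ?_, fun s t hs ht => ?_⟩
  · have hlow := fun n => two_pow_le_numInducedFree_vee (n := n) hr
    refine exists_tendsto_zero_of_bounds (fun n => (Nat.two_pow_pos _).trans_le (hlow n)) hC
      (fun ε hε => .of_forall fun n => ?_) (fun ε hε => eventually_numInducedFree_vee_le hr hε)
    calc (2 : ℝ) ^ ((1 - ε) * ((n.choose (n / 2) : ℕ) : ℝ))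
        ≤ (2 : ℝ) ^ ((n.choose (n / 2) : ℕ) : ℝ) :=
          Real.rpow_le_rpow_of_exponent_le one_le_two (by nlinarith [hC n])
      _ ≤ _ := by
          rw [Real.rpow_natCast]
          exact_mod_cast hlow n
  · have hlow := fun n => two_pow_le_numInducedFree_K (n := n) hs ht
    refine exists_tendsto_zero_of_bounds (fun n => (Nat.two_pow_pos _).trans_le (hlow n)) hC
      (fun ε hε => ?_) (fun ε hε => eventually_numInducedFree_K_le hs ht hε)
    filter_upwards [eventually_mul_choose_middle_le hε] with n hn
    calc (2 : ℝ) ^ ((2 - ε) * ((n.choose (n / 2) : ℕ) : ℝ))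
        ≤ (2 : ℝ) ^ ((n.choose (n / 2) + n.choose (n / 2 + 1) : ℕ) : ℝ) := by
          refine Real.rpow_le_rpow_of_exponent_le one_le_two ?_
          push_cast
          linarith
      _ ≤ _ := by
          rw [Real.rpow_natCast]
          exact_mod_cast hlow n
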